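/- Conventions. Names are elements of Baire space $\mathbb{N}^{\mathbb{N}}$; $\langle p,q\rangle$ is a standard pairing on $\mathbb{N}^{\mathbb N}$, $\langle p^{(0)},p^{(1)},\dots\rangle$ denotes the $s$ with $s_{\langle j,k\rangle}=p^{(j)}_k$, and $a.p$ is $p$ with the symbol $a$ put in front. $\eta$ is a standard representation of the continuous partial functions $\subseteq\mathbb{N}^{\mathbb N}\to\mathbb{N}^{\mathbb N}$ with $\Pi^0_2$ domain, and a partial function is computable iff it is $\eta_p$ for a computable $p$. A realizer of a (multi-valued) operation $f$ is a partial function mapping each name of each $x\in\operatorname{dom} f$ to a name of some element of $f(x)$; $f$ is computable if it has a computable realizer. $\nu_{\mathbb Q},\nu_{\mathbb Q^+}$ are standard total numberings of $\mathbb{Q}$ and of the positive rationals. Let $(X,d,\nu)$ be a computable metric space: $(X,d)$ is a metric space, $\nu:\mathbb{N}\to X$ is a dense sequence and the double sequence of reals $d(\nu(i),\nu(j))$ is computable. A Cauchy name of $x\in X$ is a $p$ with $d(\nu(p_i),\nu(p_j))<2^{-\min\{i,j\}}$ for all $i,j$ and $\lim_i\nu(p_i)=x$. Put $\alpha\langle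 a,r\rangle=B(\nu(a);\nu_{\mathbb{Q}^+}(r))$ (open ball), $\alpha'(0)=\emptyset$, $\alpha'(n+1)=\alpha(n)$. A name of an open set $U$ is a $p$ with $U=\bigcup\{\alpha(p_i-1): p_i\ge 1\}$. Names of closed sets $A\subseteq X$. A $\delta_{\mathrm{range}}$-name of $A\neq\emptyset$ is some $\langle p^{(0)},p^{(1)},\dots\rangle$ such that all entries are $\geq 1$ and, after subtracting $1$ from all entries, the $p^{(i)}$ are Cauchy names of points of $A$ which are dense in $A$; the name of $\emptyset$ is constantly $0$. A $\delta_{\mathrm{dist}}^{>}$-name of $A$ is a $p$ such that $\eta_p$ maps every Cauchy name of every $x\in X$ to some $r$ with $\{r_i-1: r_i\geq 1\}=\{n:\nu_{\mathbb Q}(n)<d_A(x)\}$, where $d_A(x)=\inf_{a\in A}d(x,a)\in[0,\infty]$. A $\delta_{\mathrm{range}}\sqcap\delta_{\mathrm{dist}}^{>}$-name of $A$ is a pair $\langle p,q\rangle$ of a $\delta_{\mathrm{range}}$-name and a $\delta_{\mathrm{dist}}^{>}$-name of $A$. Dugundji systems. For $A\subseteq X$ closed and nonempty and $\epsilon\in(0,\infty)$,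 a pair $((V_i)_{i\in\mathbb N},(y_i)_{i\in\mathbb N})$ of a sequence of open subsets and a sequence of points of $X$ is a Dugundji system for $A$ with coefficient $1+\epsilon$ if (0) $(V_i)_i$ is locally finite in its union: every point of $\bigcup_i V_i$ lies in some $\alpha'(a)$ which meets $V_j$ for only finitely many $j$; (1) $\bigcup_i V_i=X\setminus A$ and $y_i\in A$ for all $i$; (2) $d(x,y_i)\le(1+\epsilon)\,d_A(x)$ for all $i$ and all $x\in V_i$; (3) if $(n_i)_i\subseteq\mathbb{N}$ has $\lim_{i}d(V_{n_i},A)=0$, then $\lim_{i}\operatorname{diam}V_{n_i}=0$ (where $d(\emptyset,A)=\infty$, $\operatorname{diam}\emptyset=0$). Let $\mathcal{D}(X)$ be the set of all pairs which are a Dugundji system with coefficient $2$ for some nonempty closed $A$ (namely $A=X\setminus\bigcup_iV_i$). A $\delta_3$-name of $((V_i)_i,(y_i)_i)\in\mathcal{D}(X)$ is some $\langle\langle p,q,r\rangle,s\rangle$ such that $p=\langle p^{(0)},\dots\rangle$ with $p^{(i)}$ a name of the open set $V_i$; $\bigcup_jV_j=\bigcup_i\alpha'(q_i)$; for each $i$,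 every $j$ with $V_j\cap\alpha'(q_i)\ne\emptyset$ belongs to the finite set $F_i$ with $r_i=\sum_{k\in F_i}2^k$; and $s=\langle s^{(0)},\dots\rangle$ with $s^{(i)}$ a Cauchy name of $y_i$. Proposition. In every computable metric space $(X,d,\nu)$, the multi-valued operation $Q:\subseteq\mathbb{Q}\times\{A\subseteq X: A\text{ closed}\}\rightrightarrows\mathcal{D}(X)$ with domain $\{(\epsilon,A):\epsilon>0,\ \emptyset\neq A\neq X\}$, $$Q(\epsilon,A)=\{D\in\mathcal{D}(X): D\text{ is a Dugundji system for }A\text{ with coefficient }1+\epsilon\},$$ is $(\nu_{\mathbb Q},\delta_{\mathrm{range}}\sqcap\delta_{\mathrm{dist}}^{>};\delta_3)$-computable. That is, there is a computable $F:\subseteq\mathbb{N}^{\mathbb N}\to\mathbb{N}^{\mathbb N}$ such that whenever $\nu_{\mathbb Q}(a)=\epsilon>0$ and $p$ is a $\delta_{\mathrm{range}}\sqcap\delta_{\mathrm{dist}}^{>}$-name of a closed set $A$ with $\emptyset\ne A\ne X$, then $F(a.p)$ is defined and is a $\delta_3$-name of some element of $Q(\epsilon,A)$. -/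

import Mathlib

open Set Filter Topology TopologicalSpace

noncomputable section

namespace TTE

/-! ### Baire space, pairing, and the standard representation of continuous partial functions -/

/-- Baire space `ℕ^ℕ`, whose elements serve as names. -/
abbrev Baire : Type := ℕ → ℕ

/-- First component of `⟨p, q⟩`, where `⟨p, q⟩` is the interleaving of `p` and `q`. -/
def fstName (s : Baire) : Baire := fun n => s (2 * n)

/-- Second component of `⟨p, q⟩`. -/
def sndName (s : Baire) : Baire := fun n => s (2 * n + 1)

/-- The component `p⁽ʲ⁾` of `⟨p⁽⁰⁾, p⁽¹⁾, …⟩`, where `⟨p⁽⁰⁾, …⟩_⟨j,k⟩ = p⁽ʲ⁾_k`. -/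
def compName (s : Baire) (j : ℕ) : Baire := fun k => s (Nat.pair j k)

/-- The answer that `p`, read as a table on finite words, gives about the `n`-th output symbol
when the prefix `q 0, …, q (k - 1)` of the input is known: `0` means that the prefix is not yet
sufficient, and `m + 1` means that the output symbol is `m`. -/
def answer (p q : Baire) (n k : ℕ) : ℕ :=
  p (Nat.pair n (Encodable.encode ((List.range k).map q)))

/-- The standard representation `η` of the continuous partial functions on Baire space with `Π⁰₂`
domain: `η_p(q)_n` is the first nonzero answer of `p` along the prefixes of `q`, minus `1`, and
`η_p(q)` is defined iff all output symbols are. (This is Kleene's application of `p` to `q`.) -/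
def eta (p : Baire) : Baire →. Baire := fun q =>
  ⟨∀ n, ∃ k, answer p q n k ≠ 0, fun h n => answer p q n (Nat.find (h n)) - 1⟩

/-- Computable partial functions on Baire space: those given by a computable table, that is, a
computable function tells from `n` and a finite input prefix either the `n`-th output symbol, or
that the prefix does not suffice (within the number of steps given by its length). -/
def IsComputableFun (F : Baire →. Baire) : Prop :=
  ∃ p : Baire, Computable p ∧ F = eta p

/-! ### Representations and computable operations -/

/-- A representation `δ : ⊆ ℕ^ℕ → α`, given through its graph: `δ p x` means `p ∈ δ⁻¹{x}`. -/
abbrev Rep (α : Type*) := Baire → α → Prop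

/-- `F` is a `(δ, δ')`-realizer of the total function `f`. -/
def Realizes {α β : Type*} (δ : Rep α) (δ' : Rep β) (F : Baire →. Baire) (f : α → β) : Prop :=
  ∀ p x, δ p x → ∃ q, q ∈ F p ∧ δ' q (f x)

/-- The multi-valued operation `f` with domain `D` is `(δ; δ')`-computable: some computable
`F : ⊆ ℕ^ℕ → ℕ^ℕ` maps each name of each `x ∈ D` to a name of some element of `f x`. -/
def OpComputable {α β : Type*} (δ : Rep α) (δ' : Rep β) (D : Set α) (f : α → Set β) : Prop :=
  ∃ F : Baire →. Baire, IsComputableFun F ∧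
    ∀ p, ∀ x ∈ D, δ p x → ∃ q, q ∈ F p ∧ ∃ y ∈ f x, δ' q y

/-- The greatest lower bound `δ ⊓ δ'`: names are pairs `⟨p, q⟩` of a `δ`-name and a `δ'`-name. -/
def meetRep {α : Type*} (δ δ' : Rep α) : Rep α := fun s x => δ (fstName s) x ∧ δ' (sndName s) x

/-- The countable power `δ^ω`. -/
def powRep {α : Type*} (δ : Rep α) : Rep (ℕ → α) := fun s x => ∀ i, δ (compName s i) (x i)

/-- For a numbering `ν` and a representation `δ`: names of pairs have the form `a.p`, where `a` is
a `ν`-index of the first component and `p` a `δ`-name of the second. -/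
def numProdRep {α β : Type*} (ν : ℕ → α) (δ : Rep β) : Rep (α × β) := fun s x =>
  ν (s 0) = x.1 ∧ δ (fun n => s (n + 1)) x.2

/-- Standard total numbering of the rationals, `⟨i, ⟨j, k⟩⟩ ↦ (i - j) / (k + 1)`. -/
def nuQ (n : ℕ) : ℚ :=
  ((n.unpair.1 : ℚ) - (n.unpair.2.unpair.1 : ℚ)) / ((n.unpair.2.unpair.2 : ℚ) + 1)

/-- Standard total numbering of the positive rationals, `⟨i, j⟩ ↦ (i + 1) / (j + 1)`. -/
def nuQPos (n : ℕ) : ℚ := ((n.unpair.1 : ℚ) + 1) / ((n.unpair.2 : ℚ) + 1)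

/-- `ρ_<` extended to `[-∞, ∞]`: a name of `t` enumerates the set of all indices of rationals
below `t` (the symbol `0` is padding). -/
def lowerRep : Rep EReal := fun p t =>
  {n : ℕ | (((nuQ n : ℚ) : ℝ) : EReal) < t} = {n : ℕ | ∃ i, 1 ≤ p i ∧ n = p i - 1}

/-! ### Computable metric spaces and their hyperspaces -/

section Metric

variable {X : Type*} [MetricSpace X]

/-- `(X, d, ν)` is a computable metric space: `ν` is a dense sequence, and the double sequence of
reals `d (ν i) (ν j)` is computable. -/
structure IsComputableMetricSpace (ν : ℕ → X) : Prop where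
  dense : DenseRange ν
  dist_computable : ∃ g : ℕ × ℕ × ℕ → ℕ, Computable g ∧
    ∀ i j k, |dist (ν i) (ν j) - (nuQ (g (i, j, k)) : ℝ)| < 2⁻¹ ^ k

/-- The Cauchy representation of `X`. -/
def cauchyRep (ν : ℕ → X) : Rep X := fun p x =>
  (∀ i j, dist (ν (p i)) (ν (p j)) < 2⁻¹ ^ min i j) ∧
    Tendsto (fun i => ν (p i)) atTop (𝓝 x)

/-- The standard ball numbering `α⟨a, r⟩ = B(ν(a); ν_{ℚ⁺}(r))`. -/
def ballNum (ν : ℕ → X) (n : ℕ) : Set X :=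
  Metric.ball (ν n.unpair.1) (nuQPos n.unpair.2 : ℝ)

/-- The shift `α'` of the ball numbering: `α'(0) = ∅`, `α'(n + 1) = α(n)`. -/
def ballNum' (ν : ℕ → X) : ℕ → Set X
  | 0 => ∅
  | n + 1 => ballNum ν n

/-- The representation `δ_{Σ⁰₁(X)}` of open sets: names enumerate ideal balls with union `U`. -/
def openRep (ν : ℕ → X) : Rep (Opens X) := fun p U =>
  (U : Set X) = ⋃ i ∈ {i : ℕ | 1 ≤ p i}, ballNum ν (p i - 1)

/-- The representation `δ_range` of closed sets. A name of `A ≠ ∅` lists names (with all symbols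
increased by `1`) of the points of a sequence dense in `A`; the name of `∅` is constantly `0`. -/
def rangeRep (ν : ℕ → X) : Rep (Closeds X) := fun s A =>
  ((A : Set X) = ∅ ∧ ∀ i k, compName s i k = 0) ∨
  ((A : Set X).Nonempty ∧
    (∀ i, (∀ k, 1 ≤ compName s i k) ∧
      ∃ z ∈ (A : Set X), cauchyRep ν (fun k => compName s i k - 1) z) ∧
    ∀ x ∈ (A : Set X), ∀ U : Set X, IsOpen U → x ∈ U →
      ∃ i, ∃ z ∈ U, cauchyRep ν (fun k => compName s i k - 1) z)

/-- The distance function `d_A : X → [-∞, ∞]`, with `d_∅ = ∞`. -/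
def distFun (A : Closeds X) (x : X) : EReal := ((Metric.infEDist x (A : Set X) : ENNReal) : EReal)

/-- The representation `δ_dist^>` of closed sets: `p` is a name of `A` iff `η_p` realizes `d_A`
with respect to the Cauchy representation and lower reals. -/
def distRep (ν : ℕ → X) : Rep (Closeds X) := fun p A =>
  Realizes (cauchyRep ν) lowerRep (eta p) (distFun A)

/-! ### Local finiteness and Dugundji systems -/

/-- The class `LF` of sequences of open sets which are locally finite in their union. -/
def IsLF (ν : ℕ → X) (V : ℕ → Opens X) : Prop :=
  ∀ x, ∀ i, x ∈ V i → ∃ a : ℕ, ∃ S : Finset ℕ,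
    x ∈ ballNum' ν a ∧ {j | ((V j : Set X) ∩ ballNum' ν a).Nonempty} ⊆ (S : Set ℕ)

/-- The finite set of natural numbers with index `k`, where `F` has index `∑ i ∈ F, 2 ^ i`. -/
def finIdx (k : ℕ) : Set ℕ := {i | k.testBit i = true}

/-- The representation `δ₁`, names `⟨p, ⟨q, r⟩⟩`: `p` names the sequence of sets, `q` lists balls
covering their union, and `r i` is the index of a finite set containing every `j` such that `V j`
meets the `i`-th ball. -/
def lfRep₁ (ν : ℕ → X) : Rep (ℕ → Opens X) := fun s V =>
  IsLF ν V ∧ powRep (openRep ν) (fstName s) V ∧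
  (⋃ j, (V j : Set X)) ⊆ ⋃ i, ballNum' ν (fstName (sndName s) i) ∧
  ∀ i, {j | ((V j : Set X) ∩ ballNum' ν (fstName (sndName s) i)).Nonempty} ⊆
    finIdx (sndName (sndName s) i)

/-- The representation `δ₂`: as `δ₁`, but the balls listed by `q` have exactly the union of the
sets `V j` as their union. -/
def lfRep₂ (ν : ℕ → X) : Rep (ℕ → Opens X) := fun s V =>
  lfRep₁ ν s V ∧ (⋃ j, (V j : Set X)) = ⋃ i, ballNum' ν (fstName (sndName s) i)

/-- The distance `d(V, A) ∈ [0, ∞]` between two sets (`∞` if one of them is empty). -/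
def setEDist (V A : Set X) : ENNReal := ⨅ x ∈ V, Metric.infEDist x A

/-- `(V, y)` is a Dugundji system for the nonempty closed set `A` with coefficient `1 + ε`. -/
structure IsDugundji (ν : ℕ → X) (ε : ℝ) (A : Closeds X) (V : ℕ → Opens X) (y : ℕ → X) :
    Prop where
  eps_pos : 0 < ε
  nonempty : (A : Set X).Nonempty
  locallyFinite : IsLF ν V
  iUnion_eq : (⋃ i, (V i : Set X)) = (A : Set X)ᶜ
  mem : ∀ i, y i ∈ A
  dist_le : ∀ i, ∀ x ∈ V i, dist x (y i) ≤ (1 + ε) * Metric.infDist x (A : Set X)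
  diam_tendsto : ∀ n : ℕ → ℕ,
    Tendsto (fun i => setEDist (V (n i) : Set X) (A : Set X)) atTop (𝓝 0) →
      Tendsto (fun i => Metric.ediam (V (n i) : Set X)) atTop (𝓝 0)

/-- The space `𝒟(X)` of Dugundji systems; when no coefficient is given, it is `2`. -/
def DugundjiSpace (ν : ℕ → X) : Type _ :=
  {D : (ℕ → Opens X) × (ℕ → X) // ∃ A : Closeds X, IsDugundji ν 1 A D.1 D.2}

/-- The representation `δ₃` of `𝒟(X)`: a `δ₂`-name of the cover and a name of the points. -/
def dugundjiRep (ν : ℕ → X) : Rep (DugundjiSpace ν) := fun s D =>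
  lfRep₂ ν (fstName s) D.1.1 ∧ powRep (cauchyRep ν) (sndName s) D.1.2

/-- The values of the operation `Q : ⊆ ℚ × 𝒜(X) ⇉ 𝒟(X)`: the elements of `𝒟(X)` which are
Dugundji systems for `A` with coefficient `1 + ε`. -/
def opQ (ν : ℕ → X) (x : ℚ × Closeds X) : Set (DugundjiSpace ν) :=
  {D | IsDugundji ν (x.1 : ℝ) x.2 D.1.1 D.1.2}

/-- The domain of `Q`: pairs `(ε, A)` with `ε > 0` and `∅ ≠ A ≠ X`. -/
def domQ : Set (ℚ × Closeds X) :=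
  {x | 0 < x.1 ∧ (x.2 : Set X) ≠ ∅ ∧ (x.2 : Set X) ≠ Set.univ}

end Metric

end TTE

end

/-! Write `E` for `coeff s`, so that `ε` has denominator `E + 1`. Consider balls `B(ν c, 1/(N+1))`,
each paired with a listed point `z j` of `A`, and call one admissible if a finite part of the input
certifies that every `x` in it satisfies `d_A(x) ≥ 2/(N+1)` and `d(x, z j) ≤ (1 + 1/(E+1)) d_A(x)`.
The certificate combines a lower bound on `d_A(ν c)` with an upper bound on `d(ν c, z j)`. Soundness
is `Presents.of_admissible`; by `Presents.exists_admissible` the concentric half balls still cover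
the complement of `A`.

The set `V_i` is roughly the `i`-th admissible ball minus the half balls of smaller admissible
index, given as a union of small balls that visibly qualify. A point outside `A` lies in `V_i` for
the least `i` whose closed half ball contains it (`exists_mem_piece`). The `i`-th open half ball
misses `V_j` for `j > i` (`ApproximatesDist.not_mem_cover_of_mem_piece`), which gives local
finiteness with witness `{0, …, i}`. Finally `diam V_i ≤ 2/(N+1) ≤ d(V_i, A)`. Since `1/(E+1)` is at
most both `ε` and `1`, one system serves for the coefficients `1 + ε` and `2`.

For computability, an index also encodes where its certificate is found and must bound all positions
consulted; other indices give empty sets. Hence the `n`-th output symbol is decided by the first `n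
+ 1` input symbols, without search (`exists_computableFun`). -/

noncomputable section

namespace TTE

/-! ### Computability of arithmetic and of bounded quantification -/

section Computability

variable {α : Type*} [Primcodable α]

theorem computable_add {f h : α → ℕ} (hf : Computable f) (hh : Computable h) :
    Computable fun a => f a + h a := Primrec.nat_add.to_comp.comp hf hh

theorem computable_sub {f h : α → ℕ} (hf : Computable f) (hh : Computable h) :
    Computable fun a => f a - h a := Primrec.nat_sub.to_comp.comp hf hh

theorem computable_mul {f h : α → ℕ} (hf : Computable f) (hh : Computable h) :
    Computable fun a => f a * h a := Primrec.nat_mul.to_comp.comp hf hh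

theorem computable_div {f h : α → ℕ} (hf : Computable f) (hh : Computable h) :
    Computable fun a => f a / h a := Primrec.nat_div.to_comp.comp hf hh

theorem computable_mod {f h : α → ℕ} (hf : Computable f) (hh : Computable h) :
    Computable fun a => f a % h a := Primrec.nat_mod.to_comp.comp hf hh

theorem computable_natPair {f h : α → ℕ} (hf : Computable f) (hh : Computable h) :
    Computable fun a => Nat.pair (f a) (h a) := Primrec₂.natPair.to_comp.comp hf hh

theorem computable_two_pow {f : α → ℕ} (hf : Computable f) : Computable fun a => 2 ^ f a := by
  have h : Primrec₂ fun a b : ℕ => a ^ b := Primrec₂.unpaired'.1 Nat.Primrec.pow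
  exact h.to_comp.comp (Computable.const 2) hf

theorem computable_unpair_fst {f : α → ℕ} (hf : Computable f) :
    Computable fun a => (f a).unpair.1 := Computable.fst.comp (Computable.unpair.comp hf)

theorem computable_unpair_snd {f : α → ℕ} (hf : Computable f) :
    Computable fun a => (f a).unpair.2 := Computable.snd.comp (Computable.unpair.comp hf)

theorem computable_le {f h : α → ℕ} (hf : Computable f) (hh : Computable h) :
    Computable fun a => decide (f a ≤ h a) :=
  (Primrec.nat_le.decide.to_comp).comp hf hh

theorem computable_eq {f h : α → ℕ} (hf : Computable f) (hh : Computable h) :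
    Computable fun a => decide (f a = h a) :=
  ((Primrec.eq (α := ℕ)).decide.to_comp).comp hf hh

theorem computable_and {f h : α → Bool} (hf : Computable f) (hh : Computable h) :
    Computable fun a => f a && h a := Primrec.and.to_comp.comp hf hh

theorem computable_or {f h : α → Bool} (hf : Computable f) (hh : Computable h) :
    Computable fun a => f a || h a := Primrec.or.to_comp.comp hf hh

theorem computable_not {f : α → Bool} (hf : Computable f) :
    Computable fun a => !f a := Primrec.not.to_comp.comp hf

theorem computable_lookup {l : α → List ℕ} {f : α → ℕ} (hl : Computable l) (hf : Computable f) :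
    Computable fun a => (l a).getD (f a) 0 := (Primrec.list_getD 0).to_comp.comp hl hf

/-- Bounded universal quantification. -/
def allBelow (f : ℕ → Bool) (n : ℕ) : Bool := Nat.rec true (fun j b => b && f j) n

theorem allBelow_iff (f : ℕ → Bool) (n : ℕ) : allBelow f n = true ↔ ∀ j < n, f j = true := by
  induction n with
  | zero => simp [allBelow]
  | succ n ih =>
    have : allBelow f (n + 1) = (allBelow f n && f n) := rfl
    rw [this, Bool.and_eq_true, ih, Nat.forall_lt_succ_right]

theorem computable_allBelow {f : α → ℕ → Bool} {h : α → ℕ} (hf : Computable₂ f)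
    (hh : Computable h) : Computable fun a => allBelow (f a) (h a) := by
  refine Computable.nat_rec (h := fun a jb => jb.2 && f a jb.1) hh (Computable.const true) ?_
  exact computable_and (Computable.snd.comp Computable.snd)
    (hf.comp Computable.fst (Computable.fst.comp Computable.snd))

end Computability

/-! ### Functions whose `n`-th output symbol depends on the first `n + 1` input symbols -/

/-- If the `n`-th output symbol is computed from the first `n + 1` input symbols, then the
function is computable. -/
theorem exists_computableFun (G : List ℕ → ℕ → ℕ) (hG : Computable₂ G) :
    ∃ F : Baire →. Baire, IsComputableFun F ∧
      ∀ q : Baire, (fun n => G ((List.range (n + 1)).map q) n) ∈ F q := by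
  let dec : ℕ → List ℕ := Denumerable.ofNat (List ℕ)
  have hdec : Computable dec := Computable.ofNat _
  -- The only nonzero answer is at prefix length `n + 1`, so it is the one `eta` selects.
  let p : Baire := fun m => bif decide ((dec m.unpair.2).length = m.unpair.1 + 1) then
    G (dec m.unpair.2) m.unpair.1 + 1 else 0
  have hp : Computable p := by
    have h1 : Computable fun m : ℕ => m.unpair.1 := computable_unpair_fst Computable.id
    have h2 : Computable fun m : ℕ => dec m.unpair.2 :=
      hdec.comp (computable_unpair_snd Computable.id)
    exact Computable.cond
      (computable_eq (Computable.list_length.comp h2) (computable_add h1 (Computable.const 1)))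
      (computable_add (hG.comp h2 h1) (Computable.const 1)) (Computable.const 0)
  refine ⟨eta p, ⟨p, hp, rfl⟩, fun q => ?_⟩
  have hans : ∀ n k, answer p q n k =
      if k = n + 1 then G ((List.range (n + 1)).map q) n + 1 else 0 := by
    intro n k
    have : dec (Encodable.encode ((List.range k).map q)) = (List.range k).map q :=
      Denumerable.ofNat_encode _
    simp only [answer, p, Nat.unpair_pair, this, List.length_map, List.length_range]
    by_cases h : k = n + 1 <;> simp [h]
  have hdom : ∀ n, ∃ k, answer p q n k ≠ 0 := fun n => ⟨n + 1, by simp [hans]⟩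
  refine ⟨hdom, ?_⟩
  funext n
  have h := Nat.find_spec (hdom n)
  change answer p q n (Nat.find (hdom n)) - 1 = _
  rw [hans] at h ⊢
  split_ifs at h ⊢ with hk
  · rfl
  · exact absurd rfl h

/-! ### The construction -/

/-- Index of the centre of the ball described by an index. -/
def center (i : ℕ) : ℕ := i.unpair.1

/-- The ball described by an index has radius `1 / (scale i + 1)`. -/
def scale (i : ℕ) : ℕ := i.unpair.2.unpair.1

/-- The distance of the centre from the closed set is to exceed `level i / (scale i + 1)`. -/
def level (i : ℕ) : ℕ := i.unpair.2.unpair.2.unpair.1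

/-- Index of the point of the closed set attached to an index. -/
def site (i : ℕ) : ℕ := i.unpair.2.unpair.2.unpair.2.unpair.1

/-- The output position at which the lower bound on the distance is to be found. -/
def place (i : ℕ) : ℕ := i.unpair.2.unpair.2.unpair.2.unpair.2.unpair.1

/-- The length of the input prefix for which the lower bound on the distance is to be found. -/
def steps (i : ℕ) : ℕ := i.unpair.2.unpair.2.unpair.2.unpair.2.unpair.2.unpair.1

/-- The denominator minus `1` of the coefficient used. -/
def coeff (s : Baire) : ℕ := (s 0).unpair.2.unpair.2

/-- The position in the input of the answer of the distance name at a constant sequence. -/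
def answerPos (c n k : ℕ) : ℕ :=
  2 * Nat.pair n (Encodable.encode ((List.range k).map fun _ => c)) + 2

/-- The position in the input of the `k`-th symbol of the `j`-th point. -/
def pointPos (j k : ℕ) : ℕ := 2 * Nat.pair j k + 1

/-- The index `i` is admissible: the first `i + 1` symbols of the input `s` show that the ball
with index `i` is suitably small in comparison with its distance from the closed set and that the
point attached to it is suitably close. Here `g` approximates the distances. -/
def admissible (g : ℕ × ℕ × ℕ → ℕ) (s : Baire) (i : ℕ) : Bool :=
  -- `eta` uses the first nonzero answer, so all earlier ones must be seen to vanish.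
  allBelow (fun k => decide (answerPos (center i) (place i) k ≤ i) &&
      decide (s (answerPos (center i) (place i) k) = 0)) (steps i) &&
    (decide (answerPos (center i) (place i) (steps i) ≤ i) &&
    -- The shift by 2: one for `answer`, one for the padding symbol of `lowerRep`.
    (decide (s (answerPos (center i) (place i) (steps i)) =
      Nat.pair (level i) (Nat.pair 0 (scale i)) + 2) &&
    (decide (pointPos (site i) (scale i) ≤ i) &&
    -- With `G` the value of `g` and `T` the level, this says `G + 4 ≤ (1 + 1/(E+1)) (T - 1)`. On
    -- the ball, `G + 4` bounds `(N+1) d(x, z j)` from above (errors: 2 from `g`, 1 from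
    -- approximating `z j`, 1 from `x`) and `T - 1` bounds `(N+1) d_A(x)` from below.
    decide ((g (center i, s (pointPos (site i) (scale i)) - 1, scale i) + 4) * (coeff s + 1) +
      (coeff s + 2) ≤ (coeff s + 2) * level i))))

/-- The ball with centre `k.unpair.1` and radius `1 / (k.unpair.2 + 1)` is visibly contained in
the `i`-th ball and disjoint from the concentric half balls with smaller admissible indices. -/
def isPiece (g : ℕ × ℕ × ℕ → ℕ) (s : Baire) (i k : ℕ) : Bool :=
  admissible g s i &&
    -- The 3 is the error 2 of `g` plus the radius of the small ball. In the second test, division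
    -- by `2 * (scale j + 1)` leaves a margin of 3, where 2 would already ensure disjointness.
    (decide ((g (k.unpair.1, center i, k.unpair.2) + 3) * (scale i + 1) ≤ k.unpair.2 + 1) &&
    allBelow (fun j => !admissible g s j ||
      decide (k.unpair.2 + 1 + 6 * (scale j + 1) ≤
        g (k.unpair.1, center j, k.unpair.2) * (2 * (scale j + 1)))) i)

/-- The `k`-th symbol of the name of the `i`-th open set. -/
def pieceEntry (g : ℕ × ℕ × ℕ → ℕ) (s : Baire) (i k : ℕ) : ℕ :=
  bif isPiece g s i k then Nat.pair k.unpair.1 (Nat.pair 0 k.unpair.2) + 1 else 0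

/-- The `i`-th ball of the cover witnessing local finiteness. -/
def coverEntry (g : ℕ × ℕ × ℕ → ℕ) (s : Baire) (i : ℕ) : ℕ :=
  bif admissible g s i then Nat.pair (center i) (Nat.pair 0 (2 * scale i + 1)) + 1 else 0

/-- The name of the Dugundji system constructed from the input `s`. -/
def output (g : ℕ × ℕ × ℕ → ℕ) (s : Baire) (n : ℕ) : ℕ :=
  bif decide (n % 2 = 1) then s (pointPos (site (n / 2).unpair.1) (n / 2).unpair.2) - 1
  else bif decide (n / 2 % 2 = 0) then
    pieceEntry g s (n / 2 / 2).unpair.1 (n / 2 / 2).unpair.2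
  else bif decide (n / 2 / 2 % 2 = 0) then coverEntry g s (n / 2 / 2 / 2)
  -- The index of `{0, …, i}`, where `i` is the position in this component.
  else 2 ^ (n / 2 / 2 / 2 + 1) - 1

/-! ### Dependence of the output on initial segments of the input -/

theorem site_le (i : ℕ) : site i ≤ i :=
  (Nat.unpair_left_le _).trans <| (Nat.unpair_right_le _).trans <| (Nat.unpair_right_le _).trans <|
    Nat.unpair_right_le _

/-- Apart from symbol 0, read through `coeff`, each position consulted is itself required to be at
most `i`. -/
theorem admissible_congr (g : ℕ × ℕ × ℕ → ℕ) {s t : Baire} {i : ℕ} (h : ∀ m ≤ i, s m = t m) :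
    admissible g s i = admissible g t i := by
  have h0 : coeff s = coeff t := by simp [coeff, h 0 (Nat.zero_le i)]
  rw [Bool.eq_iff_iff]
  simp only [admissible, Bool.and_eq_true, allBelow_iff, decide_eq_true_eq, h0]
  constructor
  · rintro ⟨h1, h2, h3, h4, h5⟩
    refine ⟨fun k hk => ⟨(h1 k hk).1, ?_⟩, h2, ?_, h4, ?_⟩
    · rw [← h _ (h1 k hk).1]; exact (h1 k hk).2
    · rw [← h _ h2]; exact h3
    · rw [← h _ h4]; exact h5
  · rintro ⟨h1, h2, h3, h4, h5⟩
    refine ⟨fun k hk => ⟨(h1 k hk).1, ?_⟩, h2, ?_, h4, ?_⟩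
    · rw [h _ (h1 k hk).1]; exact (h1 k hk).2
    · rw [h _ h2]; exact h3
    · rw [h _ h4]; exact h5

theorem isPiece_congr (g : ℕ × ℕ × ℕ → ℕ) {s t : Baire} {i : ℕ} (h : ∀ m ≤ i, s m = t m)
    (k : ℕ) : isPiece g s i k = isPiece g t i k := by
  rw [Bool.eq_iff_iff]
  simp only [isPiece, Bool.and_eq_true, allBelow_iff, admissible_congr g h]
  refine and_congr_right fun _ => and_congr_right fun _ => forall₂_congr fun j hj => ?_
  rw [admissible_congr g fun m hm => h m (hm.trans hj.le)]

/-- The indices tested are at most `n`. A copied point symbol has its source no later than its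
target, because `site i ≤ i` and `Nat.pair` is monotone in its first argument. -/
theorem output_congr (g : ℕ × ℕ × ℕ → ℕ) {s t : Baire} {n : ℕ} (h : ∀ m ≤ n, s m = t m) :
    output g s n = output g t n := by
  unfold output
  by_cases h1 : n % 2 = 1
  · have h2 : pointPos (site (n / 2).unpair.1) (n / 2).unpair.2 ≤ n := by
      have h3 : Nat.pair (site (n / 2).unpair.1) (n / 2).unpair.2 ≤ n / 2 := by
        conv_rhs => rw [← Nat.pair_unpair (n / 2)]
        rcases (site_le (n / 2).unpair.1).lt_or_eq with h4 | h4
        · exact (Nat.pair_lt_pair_left _ h4).le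
        · rw [h4]
      unfold pointPos
      omega
    simp [h1, h _ h2]
  · have h2 : ∀ m ≤ (n / 2 / 2).unpair.1, s m = t m := fun m hm =>
      h m (by have := Nat.unpair_left_le (n / 2 / 2); omega)
    have h3 : ∀ m ≤ n / 2 / 2 / 2, s m = t m := fun m hm => h m (by omega)
    simp only [pieceEntry, coverEntry, isPiece_congr g h2, admissible_congr g h3, h1]
    rfl

/-! ### Computability of the construction -/

section

variable {α : Type*} [Primcodable α] {l : α → List ℕ} {f h : α → ℕ} {g : ℕ × ℕ × ℕ → ℕ}

theorem computable_center (hf : Computable f) : Computable fun a => center (f a) :=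
  computable_unpair_fst hf

theorem computable_scale (hf : Computable f) : Computable fun a => scale (f a) :=
  computable_unpair_fst (computable_unpair_snd hf)

theorem computable_level (hf : Computable f) : Computable fun a => level (f a) :=
  computable_unpair_fst (computable_unpair_snd (computable_unpair_snd hf))

theorem computable_site (hf : Computable f) : Computable fun a => site (f a) :=
  computable_unpair_fst (computable_unpair_snd (computable_unpair_snd (computable_unpair_snd hf)))

theorem computable_place (hf : Computable f) : Computable fun a => place (f a) :=
  computable_unpair_fst (computable_unpair_snd (computable_unpair_snd (computable_unpair_snd
    (computable_unpair_snd hf))))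

theorem computable_steps (hf : Computable f) : Computable fun a => steps (f a) :=
  computable_unpair_fst (computable_unpair_snd (computable_unpair_snd (computable_unpair_snd
    (computable_unpair_snd (computable_unpair_snd hf)))))

theorem computable_answerPos {c n k : α → ℕ} (hc : Computable c) (hn : Computable n)
    (hk : Computable k) : Computable fun a => answerPos (c a) (n a) (k a) := by
  have h1 : Primrec₂ fun c k : ℕ => (List.range k).map fun _ => c :=
    Primrec.list_map (Primrec.list_range.comp Primrec.snd) (Primrec.fst.comp Primrec.fst)
  have h2 : Computable fun a => Encodable.encode ((List.range (k a)).map fun _ => c a) :=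
    Computable.encode.comp (h1.to_comp.comp hc hk)
  exact computable_add (computable_mul (Computable.const 2) (computable_natPair hn h2))
    (Computable.const 2)

theorem computable_pointPos (hf : Computable f) (hh : Computable h) :
    Computable fun a => pointPos (f a) (h a) :=
  computable_add (computable_mul (Computable.const 2) (computable_natPair hf hh))
    (Computable.const 1)

theorem computable_admissible (hg : Computable g) (hl : Computable l) (hf : Computable f) :
    Computable fun a => admissible g (fun m => (l a).getD m 0) (f a) := by
  have hc := computable_center hf
  have hN := computable_scale hf
  have hn := computable_place hf
  have hE : Computable fun a => coeff fun m => (l a).getD m 0 :=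
    computable_unpair_snd (computable_unpair_snd (computable_lookup hl (Computable.const 0)))
  have hpos := computable_answerPos hc hn (computable_steps hf)
  have hpt := computable_pointPos (computable_site hf) hN
  have hpos' : Computable fun x : α × ℕ => answerPos (center (f x.1)) (place (f x.1)) x.2 :=
    computable_answerPos (hc.comp Computable.fst) (hn.comp Computable.fst) Computable.snd
  refine computable_and (computable_allBelow ?_ (computable_steps hf)) <|
    computable_and (computable_le hpos hf) <|
    computable_and (computable_eq (computable_lookup hl hpos) (computable_add
      (computable_natPair (computable_level hf) (computable_natPair (Computable.const 0) hN))
      (Computable.const 2))) <|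
    computable_and (computable_le hpt hf) <| computable_le (computable_add (computable_mul
      (computable_add (hg.comp (hc.pair ((computable_sub (computable_lookup hl hpt)
        (Computable.const 1)).pair hN))) (Computable.const 4))
      (computable_add hE (Computable.const 1))) (computable_add hE (Computable.const 2)))
      (computable_mul (computable_add hE (Computable.const 2)) (computable_level hf))
  exact computable_and (computable_le hpos' (hf.comp Computable.fst))
    (computable_eq (computable_lookup (hl.comp Computable.fst) hpos') (Computable.const 0))

theorem computable_isPiece (hg : Computable g) (hl : Computable l) (hf : Computable f)
    (hh : Computable h) :
    Computable fun a => isPiece g (fun m => (l a).getD m 0) (f a) (h a) := by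
  have h1 := computable_unpair_fst hh
  have h2 := computable_unpair_snd hh
  have hj : Computable fun x : α × ℕ => 2 * (scale x.2 + 1) := computable_mul (Computable.const 2)
    (computable_add (computable_scale Computable.snd) (Computable.const 1))
  refine computable_and (computable_admissible hg hl hf) <| computable_and
    (computable_le (computable_mul (computable_add (hg.comp (h1.pair ((computable_center hf).pair
      h2))) (Computable.const 3)) (computable_add (computable_scale hf) (Computable.const 1)))
      (computable_add h2 (Computable.const 1))) (computable_allBelow ?_ hf)
  exact computable_or
    (computable_not (computable_admissible hg (hl.comp Computable.fst) Computable.snd))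
    (computable_le (computable_add (computable_add (h2.comp Computable.fst) (Computable.const 1))
      (computable_mul (Computable.const 6) (computable_add (computable_scale Computable.snd)
        (Computable.const 1))))
      (computable_mul (hg.comp ((h1.comp Computable.fst).pair
        ((computable_center Computable.snd).pair (h2.comp Computable.fst)))) hj))

theorem computable_output (hg : Computable g) :
    Computable₂ fun (l : List ℕ) n => output g (fun m => l.getD m 0) n := by
  have half : ∀ {f : List ℕ × ℕ → ℕ}, Computable f → Computable fun x => f x / 2 :=
    fun hf => computable_div hf (Computable.const 2)
  have parity : ∀ {f : List ℕ × ℕ → ℕ} (c : ℕ), Computable f →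
      Computable fun x => decide (f x % 2 = c) :=
    fun c hf => computable_eq (computable_mod hf (Computable.const 2)) (Computable.const c)
  have hl : Computable fun x : List ℕ × ℕ => x.1 := Computable.fst
  have h0 : Computable fun x : List ℕ × ℕ => x.2 := Computable.snd
  have h1 := half h0
  have h2 := half h1
  have h3 := half h2
  refine Computable.cond (parity 1 h0) (computable_sub (computable_lookup hl (computable_pointPos
      (computable_site (computable_unpair_fst h1)) (computable_unpair_snd h1)))
      (Computable.const 1)) <|
    Computable.cond (parity 0 h1) (Computable.cond (computable_isPiece hg hl
      (computable_unpair_fst h2) (computable_unpair_snd h2)) (computable_add (computable_natPair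
        (computable_unpair_fst (computable_unpair_snd h2)) (computable_natPair (Computable.const 0)
        (computable_unpair_snd (computable_unpair_snd h2)))) (Computable.const 1))
      (Computable.const 0)) <|
    Computable.cond (parity 0 h2) (Computable.cond (computable_admissible hg hl h3)
      (computable_add (computable_natPair (computable_center h3) (computable_natPair
        (Computable.const 0) (computable_add (computable_mul (Computable.const 2)
        (computable_scale h3)) (Computable.const 1)))) (Computable.const 1)) (Computable.const 0))
      (computable_sub (computable_two_pow (computable_add h3 (Computable.const 1)))
        (Computable.const 1))

end

/-- The construction is carried out by a computable function. -/
theorem exists_computableFun_output {g : ℕ × ℕ × ℕ → ℕ} (hg : Computable g) :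
    ∃ F : Baire →. Baire, IsComputableFun F ∧ ∀ s : Baire, output g s ∈ F s := by
  obtain ⟨F, hF, h⟩ := exists_computableFun _ (computable_output hg)
  refine ⟨F, hF, fun s => ?_⟩
  convert h s using 1
  funext n
  -- The computable version extends the prefix of length `n + 1` by zeros, which `output` never
  -- notices.
  refine output_congr g fun m hm => ?_
  have : m < n + 1 := by omega
  simp [List.getD, List.getElem?_map, List.getElem?_range this]

attribute [irreducible] admissible isPiece coverEntry

section Metric

variable {X : Type*} [MetricSpace X]

/-! ### Computable metric spaces and representations -/

theorem mem_ballNum_pair {ν : ℕ → X} {a M : ℕ} {x : X} :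
    x ∈ ballNum ν (Nat.pair a (Nat.pair 0 M)) ↔ dist x (ν a) < 1 / ((M : ℝ) + 1) := by
  simp [ballNum, nuQPos]

/-- `g (a, b, N)` approximates the distance of `ν a` and `ν b` in units of `1 / (N + 1)`. -/
def ApproximatesDist (ν : ℕ → X) (g : ℕ × ℕ × ℕ → ℕ) : Prop :=
  ∀ a b N : ℕ, (g (a, b, N) : ℝ) < (N + 1) * dist (ν a) (ν b) + 1 ∧
    (N + 1) * dist (ν a) (ν b) < g (a, b, N) + 2

theorem succ_mul_inv_two_pow_le_one (N : ℕ) : ((N : ℝ) + 1) * 2⁻¹ ^ N ≤ 1 := by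
  have h : ((N : ℝ) + 1) ≤ 2 ^ N := by exact_mod_cast Nat.lt_two_pow_self (n := N)
  rw [inv_pow, mul_inv_le_iff₀ (by positivity)]
  linarith

theorem IsComputableMetricSpace.exists_approximatesDist {ν : ℕ → X}
    (hν : IsComputableMetricSpace ν) :
    ∃ g : ℕ × ℕ × ℕ → ℕ, Computable g ∧ ApproximatesDist ν g := by
  obtain ⟨g, hg, h⟩ := hν.dist_computable
  -- Scaled by `N + 1`, the error `2⁻¹ ^ N` is at most 1, and rounding down costs less than 1 more.
  -- Truncated subtraction is harmless because distances are nonnegative.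
  refine ⟨fun x => ((g x).unpair.1 - (g x).unpair.2.unpair.1) * (x.2.2 + 1) /
    ((g x).unpair.2.unpair.2 + 1), ?_, fun a b N => ?_⟩
  · exact computable_div (computable_mul (computable_sub (computable_unpair_fst hg)
      (computable_unpair_fst (computable_unpair_snd hg)))
      (computable_add (Computable.snd.comp Computable.snd) (Computable.const 1)))
      (computable_add (computable_unpair_snd (computable_unpair_snd hg)) (Computable.const 1))
  · have hd := h a b N
    simp only [nuQ] at hd
    beta_reduce
    generalize (g (a, b, N)).unpair.1 = i at hd ⊢
    generalize (g (a, b, N)).unpair.2.unpair.1 = j at hd ⊢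
    generalize (g (a, b, N)).unpair.2.unpair.2 = k at hd ⊢
    push_cast at hd
    have h0 : 0 ≤ dist (ν a) (ν b) := dist_nonneg
    generalize dist (ν a) (ν b) = d at hd h0 ⊢
    have hN := succ_mul_inv_two_pow_le_one N
    have hN0 : (0 : ℝ) < N + 1 := by positivity
    have hk0 : (0 : ℝ) < k + 1 := by positivity
    rw [abs_lt] at hd
    set v : ℝ := ((i : ℝ) - j) / (k + 1) with hv
    have h1 : (N + 1) * d - (N + 1) * v < 1 := by nlinarith [hd.2]
    have h2 : -1 < (N + 1) * d - (N + 1) * v := by nlinarith [hd.1]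
    have hm : (((i - j : ℕ) : ℝ) * (N + 1)) / (k + 1) = max ((N + 1) * v) 0 := by
      rcases le_total j i with hij | hij
      · rw [Nat.cast_sub hij, max_eq_left]
        · rw [hv]; ring
        · have : (j : ℝ) ≤ i := by exact_mod_cast hij
          have : 0 ≤ v := div_nonneg (by linarith) hk0.le
          positivity
      · rw [Nat.sub_eq_zero_of_le hij, max_eq_right]
        · simp
        · have : (i : ℝ) ≤ j := by exact_mod_cast hij
          have : v ≤ 0 := div_nonpos_of_nonpos_of_nonneg (by linarith) hk0.le
          exact mul_nonpos_of_nonneg_of_nonpos hN0.le this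
    set w := (i - j) * (N + 1) / (k + 1) with hw
    have hfl : w = ⌊(((i - j : ℕ) : ℝ) * (N + 1)) / (k + 1)⌋₊ := by
      rw [hw, ← Nat.floor_div_eq_div (K := ℝ)]
      push_cast
      rfl
    rw [hm] at hfl
    have hle : (w : ℝ) ≤ max ((N + 1) * v) 0 := by
      rw [hfl]; exact Nat.floor_le (le_max_right _ _)
    have hlt : max ((N + 1) * v) 0 < w + 1 := by
      rw [hfl]; exact Nat.lt_floor_add_one _
    have h3 : 0 ≤ (N + 1) * d := by positivity
    constructor
    · rcases le_max_iff.1 hle with h4 | h4 <;> linarith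
    · have := le_max_left ((N + 1) * v) 0
      linarith

theorem cauchyRep_const (ν : ℕ → X) (a : ℕ) : cauchyRep ν (fun _ => a) (ν a) :=
  ⟨fun i j => by simp, tendsto_const_nhds⟩

theorem cauchyRep.dist_le {ν : ℕ → X} {p : Baire} {x : X} (h : cauchyRep ν p x) (N : ℕ) :
    dist (ν (p N)) x ≤ 2⁻¹ ^ N := by
  refine le_of_tendsto (tendsto_const_nhds.dist h.2) ?_
  filter_upwards [eventually_ge_atTop N] with i hi
  simpa [min_eq_left hi] using (h.1 N i).le

theorem distFun_eq {A : Closeds X} (hA : (A : Set X).Nonempty) (x : X) :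
    distFun A x = ((Metric.infDist x (A : Set X) : ℝ) : EReal) := by
  rw [distFun, Metric.infDist, ← EReal.toReal_coe_ennreal, EReal.coe_toReal]
  · exact EReal.coe_ennreal_eq_top_iff.not.2 (Metric.infEDist_ne_top hA)
  · exact EReal.coe_ennreal_ne_bot _

/-! ### Correctness of the construction -/

/-- The input `s` consists of an index of a rational number and a name of `A` which lists names
of the points `z j`. -/
structure Presents (ν : ℕ → X) (s : Baire) (A : Closeds X) (z : ℕ → X) : Prop where
  nonempty : (A : Set X).Nonempty
  mem : ∀ j, z j ∈ (A : Set X)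
  cauchy : ∀ j, cauchyRep ν (fun k => s (pointPos j k) - 1) (z j)
  exists_dist_lt : ∀ x ∈ (A : Set X), ∀ δ > 0, ∃ j, dist x (z j) < δ
  distName : distRep ν (fun m => s (2 * m + 2)) A

theorem exists_presents {ν : ℕ → X} {s : Baire} {A : Closeds X} (hA : (A : Set X).Nonempty)
    (h : meetRep (rangeRep ν) (distRep ν) (fun n => s (n + 1)) A) : ∃ z, Presents ν s A z := by
  obtain ⟨hr, hd⟩ := h
  rcases hr with hr | ⟨-, hr, hdense⟩
  · exact absurd hr.1 hA.ne_empty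
  choose h1 z hz hcz using hr
  refine ⟨z, hA, hz, hcz, fun x hx δ hδ => ?_, hd⟩
  obtain ⟨i, w, hw, hcw⟩ := hdense x hx _ Metric.isOpen_ball (Metric.mem_ball_self hδ)
  refine ⟨i, ?_⟩
  -- The point supplied by density and the chosen `z i` have the same name, hence agree.
  rw [tendsto_nhds_unique (hcz i).2 hcw.2, dist_comm]
  exact hw

section Construction

variable {ν : ℕ → X} {s : Baire} {A : Closeds X} {z : ℕ → X} {g : ℕ × ℕ × ℕ → ℕ}

theorem answer_const (s : Baire) (c n k : ℕ) :
    answer (fun m => s (2 * m + 2)) (fun _ => c) n k = s (answerPos c n k) := rfl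

theorem nuQ_pair (T N : ℕ) : ((nuQ (Nat.pair T (Nat.pair 0 N)) : ℚ) : ℝ) = T / (N + 1) := by
  simp [nuQ]

/-- A rational number is below the distance from `A` iff the distance name says so at some
finite prefix. -/
theorem Presents.lt_infDist_iff (h : Presents ν s A z) (c T N : ℕ) :
    (T : ℝ) / (N + 1) < Metric.infDist (ν c) (A : Set X) ↔
      ∃ n k, (∀ k' < k, s (answerPos c n k') = 0) ∧
        s (answerPos c n k) = Nat.pair T (Nat.pair 0 N) + 2 := by
  -- The constant sequence `c` names `ν c`, so the relevant answers sit at positions of `s` known in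
  -- advance.
  obtain ⟨r, ⟨hdom, hr⟩, hlow⟩ := h.distName _ _ (cauchyRep_const ν c)
  have key : (T : ℝ) / (N + 1) < Metric.infDist (ν c) (A : Set X) ↔
      ∃ n, 1 ≤ r n ∧ Nat.pair T (Nat.pair 0 N) = r n - 1 := by
    have := Set.ext_iff.1 hlow (Nat.pair T (Nat.pair 0 N))
    simp only [mem_ofPred_eq] at this
    rw [← this, distFun_eq h.nonempty, EReal.coe_lt_coe_iff, nuQ_pair]
  rw [key]
  have hval : ∀ n, r n = s (answerPos c n (Nat.find (hdom n))) - 1 := fun n =>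
    (congrFun hr n).symm
  refine exists_congr fun n => ?_
  rw [hval]
  constructor
  · rintro ⟨h1, h2⟩
    refine ⟨Nat.find (hdom n), fun k' hk' => ?_, by omega⟩
    exact not_not.1 (Nat.find_min (hdom n) hk')
  · rintro ⟨k, h1, h2⟩
    have : Nat.find (hdom n) = k := by
      rw [Nat.find_eq_iff]
      refine ⟨?_, fun k' hk' => not_not.2 (h1 k' hk')⟩
      rw [answer_const, h2]
      omega
    rw [this, h2]
    omega

/-- The meaning of admissibility. -/
theorem Presents.of_admissible (h : Presents ν s A z) (hg : ApproximatesDist ν g) {i : ℕ}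
    (hi : admissible g s i = true) {x : X}
    (hx : dist x (ν (center i)) < 1 / ((scale i : ℝ) + 1)) :
    2 / ((scale i : ℝ) + 1) ≤ Metric.infDist x (A : Set X) ∧
      dist x (z (site i)) ≤ (1 + 1 / ((coeff s : ℝ) + 1)) * Metric.infDist x (A : Set X) := by
  simp only [admissible, Bool.and_eq_true, allBelow_iff, decide_eq_true_eq] at hi
  obtain ⟨h1, -, h3, -, h5⟩ := hi
  have hT := (h.lt_infDist_iff (center i) (level i) (scale i)).2
    ⟨place i, steps i, fun k hk => (h1 k hk).2, h3⟩
  have hb := (h.cauchy (site i)).dist_le (scale i)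
  have hgb := (hg (center i) (s (pointPos (site i) (scale i)) - 1) (scale i)).2
  have h6 := Metric.infDist_le_infDist_add_dist (s := (A : Set X)) (x := ν (center i)) (y := x)
  have h7 := dist_triangle x (ν (center i)) (z (site i))
  have h8 := dist_triangle (ν (center i)) (ν (s (pointPos (site i) (scale i)) - 1)) (z (site i))
  have h9 := succ_mul_inv_two_pow_le_one (scale i)
  rw [dist_comm] at h6
  have h5' : ((g (center i, s (pointPos (site i) (scale i)) - 1, scale i) : ℝ) + 4) *
      ((coeff s : ℝ) + 1) + (coeff s + 2) ≤ (coeff s + 2) * level i := by exact_mod_cast h5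
  have hGnn : (0 : ℝ) ≤ g (center i, s (pointPos (site i) (scale i)) - 1, scale i) :=
    Nat.cast_nonneg _
  generalize (g (center i, s (pointPos (site i) (scale i)) - 1, scale i) : ℝ) = G at *
  generalize hNN : (scale i : ℝ) + 1 = u at *
  generalize hEE : (coeff s : ℝ) = E at *
  have hu : 0 < u := by rw [← hNN]; positivity
  have hE : 0 ≤ E := by rw [← hEE]; positivity
  rw [div_lt_iff₀ hu] at hT
  rw [lt_div_iff₀ hu] at hx
  have hD : (level i : ℝ) - 1 < Metric.infDist x (A : Set X) * u := by nlinarith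
  have hG : u * dist (ν (center i)) (z (site i)) < G + 3 := by nlinarith
  have hG0 : 0 ≤ u * dist (ν (center i)) (z (site i)) := by positivity
  have hxz : u * dist x (z (site i)) ≤ G + 4 := by nlinarith
  clear h1 h3 h5 hb h6 h7 h8 h9 hgb hT hx hG hG0
  constructor
  · rw [div_le_iff₀ hu]
    -- As `G ≥ 0`, admissibility yields `(E+2)(T-1) ≥ 4(E+1) ≥ 2(E+2)`.
    have h2 : (E + 2) * 2 ≤ (E + 2) * ((level i : ℝ) - 1) := by
      linarith [mul_nonneg hGnn hE]
    linarith [le_of_mul_le_mul_left h2 (by linarith)]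
  · have h10 : (E + 1) * (u * dist x (z (site i))) ≤
        (E + 2) * (Metric.infDist x (A : Set X) * u) := by
      linarith [mul_le_mul_of_nonneg_left hxz (by linarith : 0 ≤ E + 1),
        mul_le_mul_of_nonneg_left hD.le (by linarith : 0 ≤ E + 2)]
    have h11 : (1 + 1 / (E + 1)) = (E + 2) / (E + 1) := by field_simp; ring
    rw [h11, div_mul_eq_mul_div, le_div_iff₀ (by positivity)]
    refine le_of_mul_le_mul_left ?_ hu
    linarith

/-- The half balls with admissible indices cover the complement of `A`. -/
theorem Presents.exists_admissible (h : Presents ν s A z) (hν : DenseRange ν)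
    (hg : ApproximatesDist ν g) {x : X} (hx : x ∉ (A : Set X)) :
    ∃ i, admissible g s i = true ∧
      dist x (ν (center i)) < 1 / (2 * ((scale i : ℝ) + 1)) := by
  have hD : 0 < Metric.infDist x (A : Set X) :=
    (A.isClosed.notMem_iff_infDist_pos h.nonempty).1 hx
  set D := Metric.infDist x (A : Set X) with hDdef
  set E := (coeff s : ℝ) with hEdef
  have hE : 0 ≤ E := by positivity
  obtain ⟨j, hj⟩ : ∃ j, dist x (z j) < (1 + 1 / (E + 1)) * D := by
    have h1 : D < (1 + 1 / (E + 1)) * D := by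
      have : 0 < 1 / (E + 1) * D := by positivity
      linarith
    obtain ⟨y, hy, hxy⟩ := (Metric.infDist_lt_iff h.nonempty).1 h1
    obtain ⟨j, hj⟩ := h.exists_dist_lt y hy _ (sub_pos.2 hxy)
    exact ⟨j, by linarith [dist_triangle x y (z j)]⟩
  set η := (1 + 1 / (E + 1)) * D - dist x (z j) with hη
  have hη0 : 0 < η := sub_pos.2 hj
  -- The losses are below `13/2 * (E+1)` from `G + 4` and at most `3(E+2) ≤ 6(E+1)` from the summand
  -- `E + 2` and from `T > (N+1) D - 2`; together less than `13(E+1)`. The term `1 / D` makes the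
  -- argument of the floor nonnegative.
  obtain ⟨N, hN⟩ := exists_nat_gt (13 / η + 1 / D)
  have h13 : 0 < 13 / η := by positivity
  have h1D : 0 < 1 / D := by positivity
  have huη : 13 < ((N : ℝ) + 1) * η := by rw [← div_lt_iff₀ hη0]; linarith
  have huD : 1 < ((N : ℝ) + 1) * D := by rw [← div_lt_iff₀ hD]; linarith
  have hu : (0 : ℝ) < N + 1 := by positivity
  obtain ⟨c, hc⟩ := hν.exists_dist_lt x (ε := 1 / (2 * ((N : ℝ) + 1))) (by positivity)
  set T := ⌊((N : ℝ) + 1) * D - 1⌋₊ with hT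
  have hT1 : (T : ℝ) ≤ (N + 1) * D - 1 := Nat.floor_le (by linarith)
  have hT2 : ((N : ℝ) + 1) * D - 1 < T + 1 := Nat.lt_floor_add_one _
  have hc' : 2 * (((N : ℝ) + 1) * dist x (ν c)) < 1 := by
    rw [lt_div_iff₀ (by positivity)] at hc
    linarith
  have hTc : (T : ℝ) / (N + 1) < Metric.infDist (ν c) (A : Set X) := by
    have h6 := Metric.infDist_le_infDist_add_dist (s := (A : Set X)) (x := x) (y := ν c)
    rw [div_lt_iff₀ hu]
    linarith [mul_le_mul_of_nonneg_left h6 hu.le]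
  clear_value T
  obtain ⟨n, k, hk1, hk2⟩ := (h.lt_infDist_iff c T N).1 hTc
  -- The padding dominates every position consulted; as a component of `i` it forces them all to be
  -- at most `i`.
  obtain ⟨pad, hpad⟩ :
      ∃ pad, pad = (∑ k' ∈ Finset.range (k + 1), answerPos c n k') + pointPos j N := ⟨_, rfl⟩
  obtain ⟨i, hi⟩ : ∃ i, i = Nat.pair c (Nat.pair N (Nat.pair T (Nat.pair j
      (Nat.pair n (Nat.pair k pad))))) := ⟨_, rfl⟩
  have hci : center i = c := by simp [center, hi]
  have hNi : scale i = N := by simp [scale, hi]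
  have hTi : level i = T := by simp [level, hi]
  have hji : site i = j := by simp [site, hi]
  have hni : place i = n := by simp [place, hi]
  have hki : steps i = k := by simp [steps, hi]
  have hpi : pad ≤ i := by
    rw [hi]
    exact (Nat.right_le_pair _ _).trans <| (Nat.right_le_pair _ _).trans <|
      (Nat.right_le_pair _ _).trans <| (Nat.right_le_pair _ _).trans <|
      (Nat.right_le_pair _ _).trans <| Nat.right_le_pair _ _
  have hpos : ∀ k' < k + 1, answerPos c n k' ≤ i := fun k' hk' => by
    have := Finset.single_le_sum (f := fun k' => answerPos c n k') (fun _ _ => Nat.zero_le _)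
      (Finset.mem_range.2 hk')
    omega
  refine ⟨i, ?_, by rwa [hci, hNi]⟩
  simp only [admissible, Bool.and_eq_true, allBelow_iff, decide_eq_true_eq, hci, hNi, hTi, hji,
    hni, hki]
  refine ⟨fun k' hk' => ⟨hpos k' (by omega), hk1 k' hk'⟩, hpos k (by omega), hk2, by omega, ?_⟩
  have hb := (h.cauchy j).dist_le N
  have hgb := (hg c (s (pointPos j N) - 1) N).1
  have h7 := dist_triangle4 (ν c) x (z j) (ν (s (pointPos j N) - 1))
  have h9 := succ_mul_inv_two_pow_le_one N
  rw [dist_comm (ν c) x, dist_comm (z j)] at h7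
  have h10 : (E + 2) * D = (E + 1) * (dist x (z j) + η) := by
    rw [hη]; field_simp; ring
  have hG : (g (c, s (pointPos j N) - 1, N) : ℝ) < (N + 1) * dist x (z j) + 5 / 2 := by
    linarith [mul_le_mul_of_nonneg_left h7 hu.le, mul_le_mul_of_nonneg_left hb hu.le]
  have h12 : ((g (c, s (pointPos j N) - 1, N) : ℝ) + 4) * (E + 1) ≤
      ((N + 1) * dist x (z j) + 13 / 2) * (E + 1) :=
    mul_le_mul_of_nonneg_right (by linarith) (by linarith)
  have h13' : (E + 2) * (((N : ℝ) + 1) * D - 2) ≤ (E + 2) * T :=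
    mul_le_mul_of_nonneg_left (by linarith) (by linarith)
  have h14 : ((N : ℝ) + 1) * ((E + 2) * D) = (N + 1) * ((E + 1) * (dist x (z j) + η)) := by
    rw [h10]
  have h15 : 13 * (E + 1) ≤ (((N : ℝ) + 1) * η) * (E + 1) :=
    mul_le_mul_of_nonneg_right huη.le (by linarith)
  have : ((g (c, s (pointPos j N) - 1, N) : ℝ) + 4) * (E + 1) + (E + 2) ≤ (E + 2) * T := by
    linarith
  rw [hEdef] at this
  exact_mod_cast this

/-! ### The open sets and the half-ball cover -/

/-- The `i`-th open set of the Dugundji system. -/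
def piece (ν : ℕ → X) (g : ℕ × ℕ × ℕ → ℕ) (s : Baire) (i : ℕ) : Opens X :=
  ⟨⋃ k ∈ {k : ℕ | 1 ≤ pieceEntry g s i k}, ballNum ν (pieceEntry g s i k - 1),
    isOpen_biUnion fun _ _ => Metric.isOpen_ball⟩

theorem mem_piece {i : ℕ} {x : X} : x ∈ (piece ν g s i : Set X) ↔
    ∃ k : ℕ, isPiece g s i k = true ∧ dist x (ν k.unpair.1) < 1 / ((k.unpair.2 : ℝ) + 1) := by
  change x ∈ ⋃ k ∈ {k : ℕ | 1 ≤ pieceEntry g s i k}, ballNum ν (pieceEntry g s i k - 1) ↔ _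
  simp only [mem_iUnion, mem_ofPred_eq, exists_prop]
  refine exists_congr fun k => ?_
  cases hk : isPiece g s i k <;> simp [pieceEntry, hk, mem_ballNum_pair]

theorem mem_ballNum'_coverEntry {i : ℕ} {x : X} : x ∈ ballNum' ν (coverEntry g s i) ↔
    admissible g s i = true ∧ dist x (ν (center i)) < 1 / (2 * ((scale i : ℝ) + 1)) := by
  cases hi : admissible g s i
  · simp [coverEntry, hi, ballNum']
  · have : (2 * (scale i : ℝ) + 1 + 1) = 2 * ((scale i : ℝ) + 1) := by ring
    simp [coverEntry, hi, ballNum', mem_ballNum_pair, this]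

theorem ApproximatesDist.admissible_of_mem_piece (hg : ApproximatesDist ν g) {i : ℕ} {x : X}
    (hx : x ∈ (piece ν g s i : Set X)) :
    admissible g s i = true ∧ dist x (ν (center i)) < 1 / ((scale i : ℝ) + 1) := by
  obtain ⟨k, hk, hxk⟩ := mem_piece.1 hx
  simp only [isPiece, Bool.and_eq_true, decide_eq_true_eq] at hk
  obtain ⟨h1, h2, -⟩ := hk
  refine ⟨h1, ?_⟩
  have h3 := (hg k.unpair.1 (center i) k.unpair.2).2
  have h4 := dist_triangle x (ν k.unpair.1) (ν (center i))
  have h2' : ((g (k.unpair.1, center i, k.unpair.2) : ℝ) + 3) * ((scale i : ℝ) + 1) ≤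
    k.unpair.2 + 1 := by exact_mod_cast h2
  have hM : (0 : ℝ) < k.unpair.2 + 1 := by positivity
  have hN : (0 : ℝ) < scale i + 1 := by positivity
  rw [lt_div_iff₀ hM] at hxk
  rw [lt_div_iff₀ hN]
  have h5 : ((k.unpair.2 : ℝ) + 1) * dist x (ν (center i)) <
      g (k.unpair.1, center i, k.unpair.2) + 3 := by
    linarith [mul_le_mul_of_nonneg_left h4 hM.le]
  have h6 : ((k.unpair.2 : ℝ) + 1) * (dist x (ν (center i)) * (scale i + 1)) <
      ((k.unpair.2 : ℝ) + 1) * 1 := by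
    linarith [mul_lt_mul_of_pos_right h5 hN]
  exact lt_of_mul_lt_mul_left h6 hM.le

theorem ApproximatesDist.not_mem_cover_of_mem_piece (hg : ApproximatesDist ν g) {i j : ℕ} {x : X}
    (hx : x ∈ (piece ν g s i : Set X)) (hj : j < i) : x ∉ ballNum' ν (coverEntry g s j) := by
  rw [mem_ballNum'_coverEntry]
  rintro ⟨hadm, hxj⟩
  obtain ⟨k, hk, hxk⟩ := mem_piece.1 hx
  simp only [isPiece, Bool.and_eq_true, allBelow_iff] at hk
  have h2 := hk.2.2 j hj
  simp only [hadm, Bool.not_true, Bool.false_or, decide_eq_true_eq] at h2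
  have h3 := (hg k.unpair.1 (center j) k.unpair.2).1
  have h4 := dist_triangle_left (ν k.unpair.1) (ν (center j)) x
  have h2' : (k.unpair.2 : ℝ) + 1 + 6 * ((scale j : ℝ) + 1) ≤
    g (k.unpair.1, center j, k.unpair.2) * (2 * ((scale j : ℝ) + 1)) := by exact_mod_cast h2
  have hM : (0 : ℝ) < k.unpair.2 + 1 := by positivity
  have hN : (0 : ℝ) < scale j + 1 := by positivity
  rw [lt_div_iff₀ hM] at hxk
  rw [lt_div_iff₀ (by positivity)] at hxj
  have h5 : (g (k.unpair.1, center j, k.unpair.2) : ℝ) <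
      (k.unpair.2 + 1) * dist x (ν (center j)) + 2 := by
    linarith [mul_le_mul_of_nonneg_left h4 hM.le]
  linarith [mul_lt_mul_of_pos_right h5 hN, mul_lt_mul_of_pos_right hxj hM]

/-- There is room on both sides: the closed half ball lies well inside the ball, and `x` is strictly
outside finitely many closed half balls. A sufficiently small ball around `x` therefore passes both
tests despite the errors of `g`. -/
theorem exists_mem_piece (hν : DenseRange ν) (hg : ApproximatesDist ν g) {i : ℕ} {x : X}
    (hi : admissible g s i = true)
    (hx : dist x (ν (center i)) ≤ 1 / (2 * ((scale i : ℝ) + 1)))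
    (hlt : ∀ j < i, admissible g s j = true →
      1 / (2 * ((scale j : ℝ) + 1)) < dist x (ν (center j))) :
    x ∈ (piece ν g s i : Set X) := by
  have hlim : Tendsto (fun M : ℕ => (M : ℝ) + 1) atTop atTop :=
    tendsto_atTop_add_const_right _ _ tendsto_natCast_atTop_atTop
  have h1 : ∀ᶠ M : ℕ in atTop, 10 * ((scale i : ℝ) + 1) ≤ M + 1 := hlim.eventually_ge_atTop _
  have h2 : ∀ᶠ M : ℕ in atTop, ∀ j < i, admissible g s j = true →
      12 * ((scale j : ℝ) + 1) ≤
        (M + 1) * (2 * ((scale j : ℝ) + 1) * dist x (ν (center j)) - 1) := by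
    refine (eventually_all_finite (finite_lt_nat i)).2 fun j hj => ?_
    by_cases hadm : admissible g s j = true
    · have hpos : 0 < 2 * ((scale j : ℝ) + 1) * dist x (ν (center j)) - 1 := by
        have := hlt j hj hadm
        rw [div_lt_iff₀ (by positivity)] at this
        linarith
      filter_upwards [(hlim.atTop_mul_const hpos).eventually_ge_atTop
        (12 * ((scale j : ℝ) + 1))] with M hM _ using hM
    · exact Eventually.of_forall fun _ h => absurd h hadm
  obtain ⟨M, hM1, hM2⟩ := (h1.and h2).exists
  have hM : (0 : ℝ) < M + 1 := by positivity
  obtain ⟨a, ha⟩ := hν.exists_dist_lt x (ε := 1 / ((M : ℝ) + 1)) (by positivity)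
  refine mem_piece.2 ⟨Nat.pair a M, ?_, by simpa using ha⟩
  simp only [isPiece, Bool.and_eq_true, allBelow_iff, Nat.unpair_pair, decide_eq_true_eq]
  rw [lt_div_iff₀ hM] at ha
  refine ⟨hi, ?_, fun j hj => ?_⟩
  · have h3 := (hg a (center i) M).1
    have h4 := dist_triangle_left (ν a) (ν (center i)) x
    have hN : (0 : ℝ) < scale i + 1 := by positivity
    rw [le_div_iff₀ (by positivity)] at hx
    have h5 : (g (a, center i, M) : ℝ) < (M + 1) * dist x (ν (center i)) + 2 := by
      linarith [mul_le_mul_of_nonneg_left h4 hM.le]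
    have : ((g (a, center i, M) : ℝ) + 3) * ((scale i : ℝ) + 1) ≤ M + 1 := by
      linarith [mul_le_mul_of_nonneg_right hx hM.le, mul_lt_mul_of_pos_right h5 hN]
    exact_mod_cast this
  · cases hadm : admissible g s j
    · rfl
    · simp only [Bool.not_true, Bool.false_or, decide_eq_true_eq]
      have h3 := (hg a (center j) M).2
      have h4 := dist_triangle x (ν a) (ν (center j))
      have hN : (0 : ℝ) < scale j + 1 := by positivity
      have h6 := hM2 j hj hadm
      have h5 : (M + 1) * dist x (ν (center j)) < (g (a, center j, M) : ℝ) + 3 := by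
        linarith [mul_le_mul_of_nonneg_left h4 hM.le]
      have : (M : ℝ) + 1 + 6 * ((scale j : ℝ) + 1) ≤
          g (a, center j, M) * (2 * ((scale j : ℝ) + 1)) := by
        linarith [mul_lt_mul_of_pos_right h5 hN]
      exact_mod_cast this

theorem Presents.iUnion_piece (h : Presents ν s A z) (hν : DenseRange ν)
    (hg : ApproximatesDist ν g) : (⋃ i, (piece ν g s i : Set X)) = (A : Set X)ᶜ := by
  ext x
  rw [mem_iUnion, mem_compl_iff]
  constructor
  · rintro ⟨i, hi⟩ hx
    obtain ⟨h1, h2⟩ := hg.admissible_of_mem_piece hi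
    have h3 := (h.of_admissible hg h1 h2).1
    rw [Metric.infDist_zero_of_mem hx] at h3
    exact absurd h3 (not_le.2 (by positivity))
  · intro hx
    obtain ⟨i, hi, hxi⟩ := h.exists_admissible hν hg hx
    -- Minimality is taken over closed half balls, so that failure at smaller indices is a strict
    -- inequality.
    have hex : ∃ i, admissible g s i = true ∧
        dist x (ν (center i)) ≤ 1 / (2 * ((scale i : ℝ) + 1)) := ⟨i, hi, hxi.le⟩
    classical
    refine ⟨Nat.find hex, exists_mem_piece hν hg (Nat.find_spec hex).1 (Nat.find_spec hex).2
      fun j hj hadm => ?_⟩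
    have := Nat.find_min hex hj
    simp only [not_and, not_le] at this
    exact this hadm

theorem Presents.iUnion_cover (h : Presents ν s A z) (hν : DenseRange ν)
    (hg : ApproximatesDist ν g) : (⋃ i, ballNum' ν (coverEntry g s i)) = (A : Set X)ᶜ := by
  ext x
  rw [mem_iUnion, mem_compl_iff]
  simp only [mem_ballNum'_coverEntry]
  refine ⟨?_, fun hx => h.exists_admissible hν hg hx⟩
  rintro ⟨i, h1, h2⟩ hx
  have hlt : (1 : ℝ) / (2 * ((scale i : ℝ) + 1)) ≤ 1 / ((scale i : ℝ) + 1) :=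
    one_div_le_one_div_of_le (by positivity) (by linarith [(scale i).cast_nonneg (α := ℝ)])
  have h3 := (h.of_admissible hg h1 (h2.trans_le hlt)).1
  rw [Metric.infDist_zero_of_mem hx] at h3
  exact absurd h3 (not_le.2 (by positivity))

theorem ApproximatesDist.le_of_inter_nonempty (hg : ApproximatesDist ν g) {i j : ℕ}
    (hij : ((piece ν g s j : Set X) ∩ ballNum' ν (coverEntry g s i)).Nonempty) : j ≤ i := by
  obtain ⟨x, hx, hxi⟩ := hij
  by_contra! hlt
  exact hg.not_mem_cover_of_mem_piece hx hlt hxi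

theorem Presents.isLF (h : Presents ν s A z) (hν : DenseRange ν) (hg : ApproximatesDist ν g) :
    IsLF ν (piece ν g s) := by
  intro x i hx
  have hx' : x ∈ ⋃ i, ballNum' ν (coverEntry g s i) := by
    rw [h.iUnion_cover hν hg, ← h.iUnion_piece hν hg]
    exact mem_iUnion.2 ⟨i, hx⟩
  obtain ⟨k, hk⟩ := mem_iUnion.1 hx'
  refine ⟨_, Finset.range (k + 1), hk, fun j hj => ?_⟩
  have := hg.le_of_inter_nonempty hj
  simp
  omega

/-- Every point of `V_i` is at least twice the radius of the `i`-th ball away from `A`. The diameter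
condition then follows by squeezing. -/
theorem Presents.ediam_piece_le (h : Presents ν s A z) (hg : ApproximatesDist ν g) (i : ℕ) :
    Metric.ediam (piece ν g s i : Set X) ≤ setEDist (piece ν g s i : Set X) (A : Set X) := by
  refine le_iInf₂ fun w hw => Metric.ediam_le fun x hx y hy => ?_
  obtain ⟨h1, hx⟩ := hg.admissible_of_mem_piece hx
  obtain ⟨-, hy⟩ := hg.admissible_of_mem_piece hy
  obtain ⟨-, hw⟩ := hg.admissible_of_mem_piece hw
  have h2 := (h.of_admissible hg h1 hw).1
  have h3 : dist x y ≤ Metric.infDist w (A : Set X) := by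
    have := dist_triangle_right x y (ν (center i))
    have h4 : 2 / ((scale i : ℝ) + 1) = 1 / (scale i + 1) + 1 / (scale i + 1) := by ring
    linarith
  rw [edist_dist, ← ENNReal.ofReal_toReal (Metric.infEDist_ne_top h.nonempty (x := w))]
  exact ENNReal.ofReal_le_ofReal h3

theorem Presents.isDugundji (h : Presents ν s A z) (hν : DenseRange ν)
    (hg : ApproximatesDist ν g) {ε : ℝ} (hε : 1 / ((coeff s : ℝ) + 1) ≤ ε) :
    IsDugundji ν ε A (piece ν g s) fun i => z (site i) where
  eps_pos := lt_of_lt_of_le (by positivity) hε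
  nonempty := h.nonempty
  locallyFinite := h.isLF hν hg
  iUnion_eq := h.iUnion_piece hν hg
  mem i := h.mem _
  dist_le i x hx := by
    obtain ⟨h1, h2⟩ := hg.admissible_of_mem_piece hx
    exact (h.of_admissible hg h1 h2).2.trans
      (mul_le_mul_of_nonneg_right (by linarith) Metric.infDist_nonneg)
  diam_tendsto n hn := tendsto_of_tendsto_of_tendsto_of_le_of_le tendsto_const_nhds hn
    (fun _ => zero_le) fun _ => h.ediam_piece_le hg _

/-! ### Reading the output as a name of the Dugundji system -/

theorem compName_fstName_fstName_output (g : ℕ × ℕ × ℕ → ℕ) (s : Baire) (i k : ℕ) :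
    compName (fstName (fstName (output g s))) i k = pieceEntry g s i k := by
  have h1 : 2 * (2 * Nat.pair i k) / 2 = 2 * Nat.pair i k := by omega
  have h2 : 2 * Nat.pair i k / 2 = Nat.pair i k := by omega
  simp [compName, fstName, output, h1, h2]

theorem fstName_sndName_fstName_output (g : ℕ × ℕ × ℕ → ℕ) (s : Baire) (i : ℕ) :
    fstName (sndName (fstName (output g s))) i = coverEntry g s i := by
  have h1 : 2 * (2 * (2 * i) + 1) / 2 = 2 * (2 * i) + 1 := by omega
  have h2 : (2 * (2 * i) + 1) / 2 = 2 * i := by omega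
  have h3 : (2 * (2 * i) + 1) % 2 = 1 := by omega
  simp [fstName, sndName, output, h1, h2, h3]

theorem sndName_sndName_fstName_output (g : ℕ × ℕ × ℕ → ℕ) (s : Baire) (i : ℕ) :
    sndName (sndName (fstName (output g s))) i = 2 ^ (i + 1) - 1 := by
  have h1 : 2 * (2 * (2 * i + 1) + 1) / 2 = 2 * (2 * i + 1) + 1 := by omega
  have h2 : (2 * (2 * i + 1) + 1) / 2 = 2 * i + 1 := by omega
  have h3 : (2 * (2 * i + 1) + 1) % 2 = 1 := by omega
  have h4 : (2 * i + 1) % 2 = 1 := by omega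
  have h5 : (2 * i + 1) / 2 = i := by omega
  simp [fstName, sndName, output, h1, h2, h3, h4, h5]

theorem compName_sndName_output (g : ℕ × ℕ × ℕ → ℕ) (s : Baire) (i k : ℕ) :
    compName (sndName (output g s)) i k = s (pointPos (site i) k) - 1 := by
  have h1 : (2 * Nat.pair i k + 1) % 2 = 1 := by omega
  have h2 : (2 * Nat.pair i k + 1) / 2 = Nat.pair i k := by omega
  simp [compName, sndName, output, h1, h2]

theorem Presents.lfRep₂_output (h : Presents ν s A z) (hν : DenseRange ν)
    (hg : ApproximatesDist ν g) : lfRep₂ ν (fstName (output g s)) (piece ν g s) := by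
  have hU : (⋃ j, (piece ν g s j : Set X)) = ⋃ i, ballNum' ν (coverEntry g s i) :=
    (h.iUnion_piece hν hg).trans (h.iUnion_cover hν hg).symm
  refine ⟨⟨h.isLF hν hg, fun i => ?_, ?_, fun i j hj => ?_⟩, ?_⟩
  · simp only [openRep, compName_fstName_fstName_output]
    rfl
  · simp only [fstName_sndName_fstName_output]
    exact hU.subset
  · rw [fstName_sndName_fstName_output] at hj
    have := hg.le_of_inter_nonempty hj
    rw [sndName_sndName_fstName_output, finIdx, mem_ofPred_eq, Nat.testBit_two_pow_sub_one]
    exact decide_eq_true (by omega)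
  · simp only [fstName_sndName_fstName_output]
    exact hU

theorem Presents.powRep_output (h : Presents ν s A z) :
    powRep (cauchyRep ν) (sndName (output g s)) fun i => z (site i) := by
  intro i
  have : compName (sndName (output g s)) i = fun k => s (pointPos (site i) k) - 1 :=
    funext fun k => compName_sndName_output g s i k
  rw [this]
  exact h.cauchy (site i)

end Construction

/-- A positive fraction has integer numerator at least 1. -/
theorem one_div_coeff_le {s : Baire} (hs : 0 < nuQ (s 0)) :
    1 / ((coeff s : ℝ) + 1) ≤ (nuQ (s 0) : ℝ) := by
  simp only [nuQ, coeff] at hs ⊢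
  push_cast
  rw [div_pos_iff_of_pos_right (by positivity), sub_pos, Nat.cast_lt] at hs
  gcongr
  rw [le_sub_iff_add_le, add_comm]
  exact_mod_cast hs

end Metric

end TTE

end

theorem mainTheorem5 {X : Type*} [MetricSpace X] (ν : ℕ → X)
    (hν : TTE.IsComputableMetricSpace ν) :
    TTE.OpComputable
      (TTE.numProdRep TTE.nuQ (TTE.meetRep (TTE.rangeRep ν) (TTE.distRep ν)))
      (TTE.dugundjiRep ν) TTE.domQ (TTE.opQ ν) := by
  obtain ⟨g, hg, happ⟩ := hν.exists_approximatesDist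
  obtain ⟨F, hF, hout⟩ := TTE.exists_computableFun_output hg
  refine ⟨F, hF, fun s x hx hs => ⟨_, hout s, ?_⟩⟩
  obtain ⟨ε, A⟩ := x
  obtain ⟨hε, hA, -⟩ := hx
  obtain ⟨hsε, hsA⟩ := hs
  obtain ⟨z, hz⟩ := TTE.exists_presents (nonempty_iff_ne_empty.2 hA) hsA
  have hcoeff : 1 / ((TTE.coeff s : ℝ) + 1) ≤ (ε : ℝ) := by
    have h := TTE.one_div_coeff_le (s := s) (hsε.symm ▸ hε)
    rwa [hsε] at h
  -- Membership in `DugundjiSpace` requires coefficient 2, whatever the size of `ε`.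
  have hone : 1 / ((TTE.coeff s : ℝ) + 1) ≤ 1 := by
    rw [div_le_one (by positivity)]
    linarith [(TTE.coeff s).cast_nonneg (α := ℝ)]
  exact ⟨⟨(TTE.piece ν g s, fun i => z (TTE.site i)), A, hz.isDugundji hν.dense happ hone⟩,
    hz.isDugundji hν.dense happ hcoeff, hz.lfRep₂_output hν.dense happ, hz.powRep_output⟩
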